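/- Let $(t_0,x_0)\in\mathbb R^2$. (i) Let $D$ be a relatively open neighborhood of $(t_0,x_0)$ in the half-plane $\{(t,x)\in\mathbb R^2: t\ge t_0\}$, and let $f:D\to\mathbb R$ be continuous and nondecreasing in $x$ for each fixed $t$ (that is, $f(t,x)\le f(t,y)$ whenever $(t,x),(t,y)\in D$ and $x\le y$). A solution of the initial value problem $$x'(t)=f(t,x(t)),\quad t\ge t_0,\qquad x(t_0)=x_0, \tag{1}$$ is a differentiable function $x:J\to\mathbb R$ on a nondegenerate interval $J$ with minimum $t_0$, with graph in $D$, satisfying $x(t_0)=x_0$ and $x'(t)=f(t,x(t))$ for all $t\in J$ (derivatives being one-sided at endpoints of $J$). It is noncontinuable if it is not the restriction of a solution defined on a strictly larger interval. Let $x^*:I=[t_0,T)\to\mathbb R$, where $T>t_0$ can be $+\infty$, be the greatest solution of (1), i.e. $x^*$ is a noncontinuable solution and every solution $x:J\to\mathbb R$ satisfies $x(t)\le x^*(t)$ for all $t\in J\cap I$. Then for every continuous function $\alpha:I\to\mathbb R$ with graph in $D$, the inequality $$\alpha(t)\le x_0+\int_{t_0}^t f(s,\alpha(s))\,ds,\quad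 t\in I,$$ implies $$\alpha(t)\le x_0+\int_{t_0}^t f(s,\alpha(s))\,ds\le x^*(t),\quad t\in I.$$ (ii) In particular, the integral form of the Gronwall--Bellman inequality holds: if $\alpha,a,b:[t_0,T)\to\mathbb R$ are continuous, where $T>t_0$ can be $+\infty$, $a(t)\ge 0$ for all $t\in[t_0,T)$, and $$\alpha(t)\le x_0+\int_{t_0}^t a(s)\,\alpha(s)\,ds+\int_{t_0}^t b(s)\,ds,\quad t\in[t_0,T),$$ then $$\alpha(t)\le x_0\exp\left(\int_{t_0}^t a(s)\,ds\right)+\int_{t_0}^t b(s)\exp\left(\int_s^t a(r)\,dr\right)ds,\quad t\in[t_0,T).$$ -/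

import Mathlib

/-- The half-open interval `[t₀, T)` of real numbers, where `T` may be `+∞`. -/
def halfOpen (t₀ : ℝ) (T : EReal) : Set ℝ := {t : ℝ | t₀ ≤ t ∧ (t : EReal) < T}

/-- `D` is a relatively open neighborhood of `(t₀, x₀)` in the half-plane `t ≥ t₀`. -/
def IsRelOpenNhd (t₀ x₀ : ℝ) (D : Set (ℝ × ℝ)) : Prop :=
  (∃ U : Set (ℝ × ℝ), IsOpen U ∧ D = U ∩ {p : ℝ × ℝ | t₀ ≤ p.1}) ∧ (t₀, x₀) ∈ D

/-- `x` is a solution on the nondegenerate interval `I`, with minimum `t₀`, of the initial value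
problem `x' = f(t, x)`, `x(t₀) = x₀`, where the right-hand side has domain `D`. Only the values
of `f` on `D` and of `x` on `I` are used; derivatives are one-sided at endpoints of `I`. -/
structure IsIVPSolution (D : Set (ℝ × ℝ)) (f : ℝ → ℝ → ℝ) (t₀ x₀ : ℝ)
    (I : Set ℝ) (x : ℝ → ℝ) : Prop where
  interval : I.OrdConnected
  nondegenerate : I.Nontrivial
  isLeast : IsLeast I t₀
  initial : x t₀ = x₀
  graph_mem : ∀ t ∈ I, (t, x t) ∈ D
  hasDeriv : ∀ t ∈ I, HasDerivWithinAt x (f t (x t)) I t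

/-- A solution that has no proper continuation. -/
def IsNoncontinuableSolution (D : Set (ℝ × ℝ)) (f : ℝ → ℝ → ℝ) (t₀ x₀ : ℝ)
    (I : Set ℝ) (x : ℝ → ℝ) : Prop :=
  IsIVPSolution D f t₀ x₀ I x ∧
    ∀ (J : Set ℝ) (y : ℝ → ℝ), IsIVPSolution D f t₀ x₀ J y → I ⊆ J → Set.EqOn x y I → I = J

/-- The greatest (noncontinuable) solution: a noncontinuable solution which lies above every
other solution at all common times. -/
def IsGreatestSolution (D : Set (ℝ × ℝ)) (f : ℝ → ℝ → ℝ) (t₀ x₀ : ℝ)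
    (I : Set ℝ) (x : ℝ → ℝ) : Prop :=
  IsNoncontinuableSolution D f t₀ x₀ I x ∧
    ∀ (J : Set ℝ) (y : ℝ → ℝ), IsIVPSolution D f t₀ x₀ J y → ∀ t ∈ J ∩ I, y t ≤ x t

open MeasureTheory Set Filter Topology intervalIntegral

/-! Write `β t = x₀ + ∫ f s (α s)`, so `α ≤ β`. The bound `β ≤ xs` is propagated to the right by
continuous induction. Suppose it holds at `t₁`. If `α t₁ < xs t₁`, then `α < xs` just after `t₁`,
and integrating the monotone `f` gives `β ≤ xs` there. Otherwise `α`, `β` and `xs` meet at `t₁`, and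
`α` is a subsolution restarted from that point. Monotone iteration from `α` then yields a local
solution above `β` (`exists_local_solution_ge`). Glued to `xs` it solves the original problem, so it
lies below `xs` by maximality. The Gronwall–Bellman bound is proved independently, with an
integrating factor. -/

/-- A subsolution of the integral equation `u t = x₁ + ∫ g s (u s)`, with `g` continuous, bounded and
nondecreasing in the second variable, lies below some solution (monotone iteration). -/
lemma exists_integral_solution_ge {g : ℝ → ℝ → ℝ} (hg : Continuous fun p : ℝ × ℝ => g p.1 p.2)
    {M : ℝ} (hM : ∀ t x, |g t x| ≤ M) (hmono : ∀ t, Monotone (g t))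
    {α : ℝ → ℝ} (hα : Continuous α) {t₁ t₂ x₁ : ℝ} (h12 : t₁ ≤ t₂)
    (hsub : ∀ t ∈ Icc t₁ t₂, α t ≤ x₁ + ∫ s in t₁..t, g s (α s)) :
    ∃ u : ℝ → ℝ, Continuous u ∧ (∀ t ∈ Icc t₁ t₂, u t = x₁ + ∫ s in t₁..t, g s (u s)) ∧
      ∀ t ∈ Icc t₁ t₂, α t ≤ u t := by
  -- Picard iterates started at `α`: the subsolution inequality is the first monotonicity step, and
  -- monotonicity of `g` preserves it.
  let v : ℕ → ℝ → ℝ := fun n => Nat.rec α (fun _ w t => x₁ + ∫ s in t₁..t, g s (w s)) n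
  have v0 : v 0 = α := rfl
  have vs : ∀ n t, v (n + 1) t = x₁ + ∫ s in t₁..t, g s (v n s) := fun n t => rfl
  have gcomp : ∀ w : ℝ → ℝ, Continuous w → Continuous fun s => g s (w s) := fun w hw =>
    hg.comp (continuous_id.prodMk hw)
  have vc : ∀ n, Continuous (v n) := by
    intro n
    induction n with
    | zero => exact hα
    | succ n ih =>
      exact continuous_const.add
        (continuous_primitive (fun a b => (gcomp _ ih).intervalIntegrable a b) t₁)
  have vmono : ∀ n, ∀ t ∈ Icc t₁ t₂, v n t ≤ v (n + 1) t := by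
    intro n
    induction n with
    | zero => exact hsub
    | succ n ih =>
      intro t ht
      rw [vs, vs (n + 1)]
      gcongr
      refine integral_mono_on ht.1 ((gcomp _ (vc n)).intervalIntegrable _ _)
        ((gcomp _ (vc (n + 1))).intervalIntegrable _ _) fun s hs => ?_
      exact hmono s (ih s ⟨hs.1, hs.2.trans ht.2⟩)
  have vmono' : ∀ t ∈ Icc t₁ t₂, Monotone fun n => v n t := fun t ht =>
    monotone_nat_of_le_succ fun n => vmono n t ht
  have vbdd : ∀ t ∈ Icc t₁ t₂, BddAbove (range fun n => v n t) := by
    intro t ht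
    refine ⟨x₁ + M * |t - t₁|, ?_⟩
    rintro _ ⟨n, rfl⟩
    refine (vmono n t ht).trans ?_
    rw [vs]
    gcongr
    exact (le_abs_self _).trans
      (norm_integral_le_of_norm_le_const (f := fun s => g s (v n s)) fun s _ => hM s _)
  let w : ℝ → ℝ := fun t => ⨆ n, v n t
  have vlim : ∀ t ∈ Icc t₁ t₂, Tendsto (fun n => v n t) atTop (𝓝 (w t)) := fun t ht =>
    tendsto_atTop_ciSup (vmono' t ht) (vbdd t ht)
  have hsubset : ∀ t ∈ Icc t₁ t₂, Set.uIoc t₁ t ⊆ Icc t₁ t₂ := by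
    intro t ht s hs
    rw [uIoc_of_le ht.1] at hs
    exact ⟨hs.1.le, hs.2.trans ht.2⟩
  have weq : ∀ t ∈ Icc t₁ t₂, w t = x₁ + ∫ s in t₁..t, g s (w s) := by
    intro t ht
    refine tendsto_nhds_unique ((vlim t ht).comp (tendsto_add_atTop_nat 1)) ?_
    have : Tendsto (fun n => ∫ s in t₁..t, g s (v n s)) atTop (𝓝 (∫ s in t₁..t, g s (w s))) := by
      refine tendsto_integral_filter_of_dominated_convergence (fun _ => M)
        (Eventually.of_forall fun n => (gcomp _ (vc n)).aestronglyMeasurable)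
        (Eventually.of_forall fun n => Eventually.of_forall fun s _ => hM s _)
        intervalIntegrable_const (Eventually.of_forall fun s hs => ?_)
      have hgs : Continuous (g s) := hg.comp (continuous_const.prodMk continuous_id)
      exact (hgs.tendsto _).comp (vlim s (hsubset t ht hs))
    exact this.const_add x₁
  -- As a supremum, `w` is not yet known to be continuous; integrability of `g s (w s)` makes it a
  -- primitive, hence continuous.
  have wint : IntegrableOn (fun s => g s (w s)) (uIcc t₁ t₂) := by
    rw [uIcc_of_le h12]
    refine Integrable.of_bound ?_ M (Eventually.of_forall fun s => hM s _)
    refine aestronglyMeasurable_of_tendsto_ae (u := atTop) (f := fun n s => g s (v n s))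
      (fun n => (gcomp _ (vc n)).aestronglyMeasurable) ?_
    filter_upwards [ae_restrict_mem measurableSet_Icc] with s hs
    have hgs : Continuous (g s) := hg.comp (continuous_const.prodMk continuous_id)
    exact (hgs.tendsto _).comp (vlim s hs)
  have wcont : ContinuousOn w (Icc t₁ t₂) := by
    have h := (continuousOn_primitive_interval wint).const_add x₁
    rw [uIcc_of_le h12] at h
    exact h.congr weq
  have ueq : ∀ t ∈ Icc t₁ t₂, IccExtend h12 ((Icc t₁ t₂).domRestrict w) t = w t := fun t ht =>
    IccExtend_of_mem h12 _ ht
  refine ⟨IccExtend h12 ((Icc t₁ t₂).domRestrict w), wcont.domRestrict.Icc_extend', fun t ht => ?_,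
    fun t ht => ?_⟩
  · rw [ueq t ht, weq t ht]
    congr 1
    refine integral_congr fun s hs => ?_
    rw [uIcc_of_le ht.1] at hs
    exact congrArg (g s) (ueq s ⟨hs.1, hs.2.trans ht.2⟩).symm
  · rw [ueq t ht]
    exact (vmono' t ht).ge_of_tendsto (vlim t ht) 0

/-- Local version of `exists_integral_solution_ge`, for a right-hand side defined near the initial
point only: the solution lies above the integral of the subsolution. -/
lemma exists_local_solution_ge {D : Set (ℝ × ℝ)} {f : ℝ → ℝ → ℝ} {t₁ t₂ x₁ : ℝ} (h12 : t₁ < t₂)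
    (hf : ContinuousOn (fun p : ℝ × ℝ => f p.1 p.2) D)
    (hmono : ∀ t x y : ℝ, (t, x) ∈ D → (t, y) ∈ D → x ≤ y → f t x ≤ f t y)
    {U : Set (ℝ × ℝ)} (hU : IsOpen U) (hxU : (t₁, x₁) ∈ U) (hUD : ∀ p ∈ U, t₁ ≤ p.1 → p ∈ D)
    {α : ℝ → ℝ} (hα : ContinuousOn α (Icc t₁ t₂)) (hα1 : α t₁ = x₁)
    (hsub : ∀ t ∈ Icc t₁ t₂, α t ≤ x₁ + ∫ s in t₁..t, f s (α s)) :
    ∃ t₃ ∈ Ioc t₁ t₂, ∃ u : ℝ → ℝ, u t₁ = x₁ ∧ (∀ t ∈ Icc t₁ t₃, (t, u t) ∈ D) ∧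
      (∀ t ∈ Icc t₁ t₃, HasDerivWithinAt u (f t (u t)) (Icc t₁ t₃) t) ∧
      ∀ t ∈ Icc t₁ t₃, x₁ + ∫ s in t₁..t, f s (α s) ≤ u t := by
  obtain ⟨r, hr, hball⟩ := Metric.nhds_basis_closedBall.mem_iff.1 (hU.mem_nhds hxU)
  -- Clamping both variables to a rectangle inside `D` makes `f` globally defined, continuous and
  -- bounded; clamping is monotone, so monotonicity in `x` survives.
  let p : ℝ → ℝ := fun t => projIcc t₁ (t₁ + r) (by linarith) t
  let q : ℝ → ℝ := fun x => projIcc (x₁ - r) (x₁ + r) (by linarith) x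
  have hp : ∀ t, p t ∈ Icc t₁ (t₁ + r) := fun t => Subtype.coe_prop _
  have hq : ∀ t, q t ∈ Icc (x₁ - r) (x₁ + r) := fun t => Subtype.coe_prop _
  have pc : Continuous p := continuous_subtype_val.comp continuous_projIcc
  have qc : Continuous q := continuous_subtype_val.comp continuous_projIcc
  have p_eq : ∀ t ∈ Icc t₁ (t₁ + r), p t = t := fun t ht =>
    congrArg Subtype.val (projIcc_of_mem _ ht)
  have q_eq : ∀ t ∈ Icc (x₁ - r) (x₁ + r), q t = t := fun t ht =>
    congrArg Subtype.val (projIcc_of_mem _ ht)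
  have hrect : Icc t₁ (t₁ + r) ×ˢ Icc (x₁ - r) (x₁ + r) ⊆ D := by
    rintro ⟨t, x⟩ ⟨ht, hx⟩
    refine hUD _ (hball ?_) ht.1
    rw [← closedBall_prod_same]
    simp only [mem_prod, Real.closedBall_eq_Icc]
    exact ⟨⟨by linarith [ht.1], ht.2⟩, hx⟩
  let g : ℝ → ℝ → ℝ := fun t x => f (p t) (q x)
  have hg : Continuous fun z : ℝ × ℝ => g z.1 z.2 :=
    hf.comp_continuous (f := fun z : ℝ × ℝ => (p z.1, q z.2))
      ((pc.comp continuous_fst).prodMk (qc.comp continuous_snd)) fun z => hrect ⟨hp _, hq _⟩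
  have gmono : ∀ t, Monotone (g t) := fun t x y hxy =>
    hmono _ _ _ (hrect ⟨hp _, hq _⟩) (hrect ⟨hp _, hq _⟩) (monotone_projIcc _ hxy)
  obtain ⟨M, hM⟩ := (isCompact_Icc.prod isCompact_Icc).exists_bound_of_continuousOn
    (hf.mono hrect)
  have gbdd : ∀ t x, |g t x| ≤ M := fun t x => hM (p t, q x) ⟨hp _, hq _⟩
  have hM0 : 0 ≤ M := (abs_nonneg _).trans (gbdd 0 0)
  -- a time up to which both `α` and the solution stay in the rectangle
  obtain ⟨δ, hδ, hαδ⟩ : ∃ δ > 0, ∀ t ∈ Icc t₁ t₂, t < t₁ + δ → α t ∈ Icc (x₁ - r) (x₁ + r) := by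
    have h := Metric.continuousWithinAt_iff.1 (hα t₁ (left_mem_Icc.2 h12.le)) r hr
    obtain ⟨δ, hδ, h⟩ := h
    refine ⟨δ, hδ, fun t ht htδ => ?_⟩
    have := h ht (by rw [Real.dist_eq, abs_of_nonneg (by linarith [ht.1])]; linarith)
    rw [hα1, Real.dist_eq] at this
    have := abs_lt.1 this
    constructor <;> linarith
  -- `M * ε ≤ r` keeps the solution in the rectangle, since its slope is at most `M`. The witness
  -- divides by `M + 1` because `M` may be `0`.
  obtain ⟨ε, hε, hε1, hε2, hε3, hε4⟩ :
      ∃ ε > 0, ε < δ ∧ ε ≤ r ∧ t₁ + ε ≤ t₂ ∧ M * ε ≤ r := by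
    refine ⟨min (min (δ / 2) r) (min (t₂ - t₁) (r / (M + 1))), ?_, ?_, ?_, ?_, ?_⟩
    · have : 0 < t₂ - t₁ := by linarith
      positivity
    · exact ((min_le_left _ _).trans (min_le_left _ _)).trans_lt (by linarith)
    · exact (min_le_left _ _).trans (min_le_right _ _)
    · linarith [(min_le_right (min (δ / 2) r) _).trans (min_le_left (t₂ - t₁) (r / (M + 1)))]
    · have h := (min_le_right (min (δ / 2) r) _).trans (min_le_right (t₂ - t₁) (r / (M + 1)))
      calc _ ≤ (M + 1) * (r / (M + 1)) := by gcongr; linarith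
        _ = r := by field_simp
  have h13 : t₁ ≤ t₁ + ε := by linarith
  let αe : ℝ → ℝ := IccExtend h13 ((Icc t₁ (t₁ + ε)).domRestrict α)
  have αe_eq : ∀ t ∈ Icc t₁ (t₁ + ε), αe t = α t := fun t ht => IccExtend_of_mem h13 _ ht
  have hsubI : Icc t₁ (t₁ + ε) ⊆ Icc t₁ t₂ := Icc_subset_Icc_right hε3
  have αe_cont : Continuous αe := (hα.mono hsubI).domRestrict.Icc_extend'
  have g_eq : ∀ s ∈ Icc t₁ (t₁ + ε), g s (αe s) = f s (α s) := by
    intro s hs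
    change f (p s) (q (αe s)) = _
    rw [αe_eq s hs, p_eq s ⟨hs.1, hs.2.trans (by linarith)⟩,
      q_eq _ (hαδ s (hsubI hs) (hs.2.trans_lt (by linarith)))]
  have int_eq : ∀ t ∈ Icc t₁ (t₁ + ε),
      ∫ s in t₁..t, g s (αe s) = ∫ s in t₁..t, f s (α s) := by
    intro t ht
    refine integral_congr fun s hs => ?_
    rw [uIcc_of_le ht.1] at hs
    exact g_eq s ⟨hs.1, hs.2.trans ht.2⟩
  obtain ⟨u, uc, ueq, uge⟩ := exists_integral_solution_ge hg gbdd gmono αe_cont h13 (x₁ := x₁)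
    fun t ht => by rw [αe_eq t ht, int_eq t ht]; exact hsub t (hsubI ht)
  have gcomp : ∀ w : ℝ → ℝ, Continuous w → Continuous fun s => g s (w s) := fun w hw =>
    hg.comp (continuous_id.prodMk hw)
  have umem : ∀ t ∈ Icc t₁ (t₁ + ε), u t ∈ Icc (x₁ - r) (x₁ + r) := by
    intro t ht
    have h1 : |∫ s in t₁..t, g s (u s)| ≤ M * |t - t₁| :=
      norm_integral_le_of_norm_le_const (f := fun s => g s (u s)) fun s _ => gbdd s _
    rw [abs_of_nonneg (by linarith [ht.1] : 0 ≤ t - t₁)] at h1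
    have h2 : M * (t - t₁) ≤ M * ε := by gcongr; linarith [ht.2]
    have h3 := abs_le.1 (h1.trans (h2.trans hε4))
    rw [ueq t ht]
    constructor <;> linarith
  have gu : ∀ t ∈ Icc t₁ (t₁ + ε), g t (u t) = f t (u t) := by
    intro s hs
    change f (p s) (q (u s)) = _
    rw [p_eq s ⟨hs.1, hs.2.trans (by linarith)⟩, q_eq _ (umem s hs)]
  refine ⟨t₁ + ε, ⟨by linarith, hε3⟩, u, ?_, fun t ht => ?_, fun t ht => ?_, fun t ht => ?_⟩
  · rw [ueq t₁ (left_mem_Icc.2 h13)]; simp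
  · exact hrect ⟨⟨ht.1, ht.2.trans (by linarith)⟩, umem t ht⟩
  · have h := ((gcomp u uc).integral_hasStrictDerivAt t₁ t).hasDerivAt.const_add x₁
    rw [← gu t ht]
    exact h.hasDerivWithinAt.congr ueq (ueq t ht)
  · rw [← int_eq t ht, ueq t ht]
    gcongr
    refine integral_mono_on ht.1 ((gcomp _ αe_cont).intervalIntegrable _ _)
      ((gcomp _ uc).intervalIntegrable _ _) fun s hs => ?_
    exact gmono s (uge s ⟨hs.1, hs.2.trans ht.2⟩)

lemma Icc_subset_halfOpen {t₀ t : ℝ} {T : EReal} (ht : t ∈ halfOpen t₀ T) :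
    Icc t₀ t ⊆ halfOpen t₀ T := fun _ hs =>
  ⟨hs.1, (EReal.coe_le_coe_iff.2 hs.2).trans_lt ht.2⟩

/-- A solution can be continued by a solution which starts at one of its points. -/
lemma IsIVPSolution.glue {D : Set (ℝ × ℝ)} {f : ℝ → ℝ → ℝ} {t₀ x₀ t₁ t₃ : ℝ} {I : Set ℝ}
    {x u : ℝ → ℝ} (hx : IsIVPSolution D f t₀ x₀ I x) (h1 : t₁ ∈ I) (h13 : t₁ < t₃)
    (hu1 : u t₁ = x t₁) (huD : ∀ t ∈ Icc t₁ t₃, (t, u t) ∈ D)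
    (hu : ∀ t ∈ Icc t₁ t₃, HasDerivWithinAt u (f t (u t)) (Icc t₁ t₃) t) :
    IsIVPSolution D f t₀ x₀ (Icc t₀ t₃) fun t => if t ≤ t₁ then x t else u t := by
  have h01 : t₀ ≤ t₁ := hx.isLeast.2 h1
  have hsub : Icc t₀ t₁ ⊆ I := hx.interval.out hx.isLeast.1 h1
  set y : ℝ → ℝ := fun t => if t ≤ t₁ then x t else u t with hy
  have yl : ∀ t ∈ Icc t₀ t₁, y t = x t := fun t ht => if_pos ht.2
  have yr : ∀ t ∈ Icc t₁ t₃, y t = u t := by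
    intro t ht
    rcases ht.1.eq_or_lt with rfl | h
    · simp [hy, hu1]
    · exact if_neg h.not_ge
  refine ⟨ordConnected_Icc, ⟨t₀, ⟨le_rfl, by linarith⟩, t₃, ⟨by linarith, le_rfl⟩, by linarith⟩,
    isLeast_Icc (by linarith), ?_, fun t ht => ?_, fun t ht => ?_⟩
  · rw [yl t₀ ⟨le_rfl, h01⟩, hx.initial]
  · rcases le_total t t₁ with h | h
    · rw [yl t ⟨ht.1, h⟩]; exact hx.graph_mem t (hsub ⟨ht.1, h⟩)
    · rw [yr t ⟨h, ht.2⟩]; exact huD t ⟨h, ht.2⟩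
  · rw [← Icc_union_Icc_eq_Icc h01 h13.le]
    refine HasDerivWithinAt.union ?_ ?_
    · by_cases h : t ≤ t₁
      · have ht' : t ∈ Icc t₀ t₁ := ⟨ht.1, h⟩
        rw [yl t ht']
        exact ((hx.hasDeriv t (hsub ht')).mono hsub).congr yl (yl t ht')
      -- Away from the closure of a piece, the derivative within that piece is vacuous.
      · refine HasFDerivWithinAt.of_notMem_closure ?_
        rw [closure_Icc]
        exact fun h' => h h'.2
    · by_cases h : t₁ ≤ t
      · have ht' : t ∈ Icc t₁ t₃ := ⟨h, ht.2⟩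
        rw [yr t ht']
        exact (hu t ht').congr yr (yr t ht')
      · refine HasFDerivWithinAt.of_notMem_closure ?_
        rw [closure_Icc]
        exact fun h' => h h'.1

/-! ### Comparison with the greatest solution -/

/-- An integral subsolution lies, together with its integral, below the greatest solution. -/
lemma integral_le_greatest_solution {D : Set (ℝ × ℝ)} {f : ℝ → ℝ → ℝ} {t₀ x₀ : ℝ} {T : EReal}
    {xs : ℝ → ℝ} (hD : IsRelOpenNhd t₀ x₀ D) (hf : ContinuousOn (fun p : ℝ × ℝ => f p.1 p.2) D)
    (hmono : ∀ t x y : ℝ, (t, x) ∈ D → (t, y) ∈ D → x ≤ y → f t x ≤ f t y)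
    (hxs : IsGreatestSolution D f t₀ x₀ (halfOpen t₀ T) xs) {α : ℝ → ℝ}
    (hα : ContinuousOn α (halfOpen t₀ T)) (hαD : ∀ t ∈ halfOpen t₀ T, (t, α t) ∈ D)
    (hsub : ∀ t ∈ halfOpen t₀ T, α t ≤ x₀ + ∫ s in t₀..t, f s (α s)) :
    ∀ t ∈ halfOpen t₀ T, x₀ + ∫ s in t₀..t, f s (α s) ≤ xs t := by
  intro t ht
  have hsol := hxs.1.1
  have hI : Icc t₀ t ⊆ halfOpen t₀ T := Icc_subset_halfOpen ht
  have xsc : ContinuousOn xs (halfOpen t₀ T) := fun s hs => (hsol.hasDeriv s hs).continuousWithinAt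
  have fαc : ContinuousOn (fun s => f s (α s)) (Icc t₀ t) :=
    (hf.comp (continuousOn_id.prodMk hα) hαD).mono hI
  have fxc : ContinuousOn (fun s => f s (xs s)) (Icc t₀ t) :=
    (hf.comp (continuousOn_id.prodMk xsc) hsol.graph_mem).mono hI
  have hii : ∀ w : ℝ → ℝ, ContinuousOn (fun s => f s (w s)) (Icc t₀ t) → ∀ a ∈ Icc t₀ t,
      ∀ b ∈ Icc t₀ t, IntervalIntegrable (fun s => f s (w s)) volume a b := fun w hw a ha b hb =>
    (hw.mono (ordConnected_Icc.uIcc_subset ha hb)).intervalIntegrable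
  have h0 : t₀ ∈ Icc t₀ t := left_mem_Icc.2 ht.1
  set β : ℝ → ℝ := fun s => x₀ + ∫ r in t₀..s, f r (α r) with hβ
  have βc : ContinuousOn β (Icc t₀ t) := by
    have := (continuousOn_primitive_interval (a := t₀) (b := t) (μ := volume)
      (f := fun s => f s (α s)) (by rw [uIcc_of_le ht.1]; exact fαc.integrableOn_Icc)).const_add x₀
    rwa [uIcc_of_le ht.1] at this
  have β_add : ∀ a ∈ Icc t₀ t, ∀ b ∈ Icc t₀ t, β b = β a + ∫ r in a..b, f r (α r) := by
    intro a ha b hb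
    simp only [hβ]
    rw [add_assoc, integral_add_adjacent_intervals (hii α fαc _ h0 _ ha) (hii α fαc _ ha _ hb)]
  have xs_add : ∀ a ∈ Icc t₀ t, ∀ b ∈ Icc t₀ t, a ≤ b →
      xs b = xs a + ∫ r in a..b, f r (xs r) := by
    intro a ha b hb hab
    have hsubI : Icc a b ⊆ halfOpen t₀ T := (Icc_subset_Icc ha.1 hb.2).trans hI
    rw [integral_eq_sub_of_hasDerivAt_of_le hab (xsc.mono hsubI) (fun s hs => ?_)
      (hii xs fxc _ ha _ hb)]
    · ring
    · exact (hsol.hasDeriv s (hsubI (Ioo_subset_Icc_self hs))).hasDerivAt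
        (mem_of_superset (Icc_mem_nhds hs.1 hs.2) hsubI)
  suffices H : Icc t₀ t ⊆ {s | β s ≤ xs s} from H (right_mem_Icc.2 ht.1)
  refine IsClosed.Icc_subset_of_forall_exists_gt ?_ ?_ ?_
  · rw [inter_comm]
    exact (isClosed_Icc.isClosed_le βc (xsc.mono hI))
  · simp [hβ, hsol.initial]
  rintro t₁ ⟨h1 : β t₁ ≤ xs t₁, ht1⟩ t₂' ht2'
  have ht1I : t₁ ∈ Icc t₀ t := Ico_subset_Icc_self ht1
  -- it suffices to have the inequality on some interval to the right of `t₁`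
  suffices H : ∃ t₃ > t₁, ∀ s ∈ Icc t₁ t₃, s ≤ t → β s ≤ xs s by
    obtain ⟨t₃, h3, H⟩ := H
    have hlt : t₁ < min (min t₃ t) t₂' := lt_min (lt_min h3 ht1.2) ht2'
    exact ⟨_, H _ ⟨hlt.le, (min_le_left _ _).trans (min_le_left _ _)⟩
      ((min_le_left _ _).trans (min_le_right _ _)), hlt, min_le_right _ _⟩
  have hα1 : α t₁ ≤ β t₁ := hsub t₁ (hI ht1I)
  rcases (hα1.trans h1).lt_or_eq with hlt | heq
  · have hev : ∀ᶠ s in 𝓝[Icc t₀ t] t₁, α s < xs s :=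
      ((hα.mono hI) t₁ ht1I).eventually_lt ((xsc.mono hI) t₁ ht1I) hlt
    obtain ⟨δ, hδ, hball⟩ := Metric.mem_nhdsWithin_iff.1 hev
    refine ⟨t₁ + δ / 2, by linarith, fun s hs hst => ?_⟩
    have hsI : s ∈ Icc t₀ t := ⟨ht1.1.trans hs.1, hst⟩
    rw [β_add t₁ ht1I s hsI, xs_add t₁ ht1I s hsI hs.1]
    refine add_le_add h1 (integral_mono_on hs.1 (hii α fαc _ ht1I _ hsI)
      (hii xs fxc _ ht1I _ hsI) fun r hr => ?_)
    have hrI : r ∈ Icc t₀ t := ⟨ht1.1.trans hr.1, hr.2.trans hst⟩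
    refine hmono _ _ _ (hαD r (hI hrI)) (hsol.graph_mem r (hI hrI)) (le_of_lt (hball ⟨?_, hrI⟩))
    rw [Metric.mem_ball, Real.dist_eq, abs_of_nonneg (by linarith [hr.1])]
    linarith [hr.2, hs.2]
  -- Here `α t₁ ≤ β t₁ ≤ xs t₁` collapses to equalities, so the integral inequality can be restarted
  -- at `t₁` with initial value `xs t₁`.
  · have hβ1 : β t₁ = xs t₁ := le_antisymm h1 (heq ▸ hα1)
    obtain ⟨⟨U, hU, hDU⟩, -⟩ := hD
    have hsubI : Icc t₁ t ⊆ Icc t₀ t := Icc_subset_Icc_left ht1.1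
    have hU1 : (t₁, xs t₁) ∈ U := by
      have := hsol.graph_mem t₁ (hI ht1I)
      rw [hDU] at this
      exact this.1
    obtain ⟨t₃, ht3, u, hu1, huD, hu, hβu⟩ := exists_local_solution_ge ht1.2 hf hmono hU hU1
      (fun p hp hp1 => by rw [hDU]; exact ⟨hp, ht1.1.trans hp1⟩)
      (hα.mono (hsubI.trans hI)) heq fun s hs => by
        rw [← hβ1, ← β_add t₁ ht1I s (hsubI hs)]; exact hsub s (hI (hsubI hs))
    refine ⟨t₃, ht3.1, fun s hs hst => ?_⟩
    have hsI : s ∈ Icc t₀ t := ⟨ht1.1.trans hs.1, hst⟩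
    have h := hxs.2 _ _ (hsol.glue (hI ht1I) ht3.1 hu1 huD hu) s
      ⟨⟨hsI.1, hs.2⟩, hI hsI⟩
    have h' := hβu s hs
    rw [← hβ1, ← β_add t₁ ht1I s hsI] at h'
    rcases hs.1.eq_or_lt with rfl | hlt
    · exact h1
    · rw [if_neg hlt.not_ge] at h
      exact h'.trans h

/-! ### The linear case -/

/-- The integral form of the Gronwall–Bellman inequality on a compact interval. -/
lemma gronwall_bellman_of_continuous {t₀ x₀ t : ℝ} (ht : t₀ ≤ t) {α a b : ℝ → ℝ}
    (hα : Continuous α) (ha : Continuous a) (hb : Continuous b) (ha0 : ∀ s ∈ Icc t₀ t, 0 ≤ a s)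
    (hsub : ∀ s ∈ Icc t₀ t,
      α s ≤ x₀ + (∫ r in t₀..s, a r * α r) + ∫ r in t₀..s, b r) :
    α t ≤ x₀ * Real.exp (∫ s in t₀..t, a s) +
      ∫ s in t₀..t, b s * Real.exp (∫ r in s..t, a r) := by
  let A : ℝ → ℝ := fun s => ∫ r in t₀..s, a r
  let β : ℝ → ℝ := fun s => x₀ + (∫ r in t₀..s, a r * α r) + ∫ r in t₀..s, b r
  have dA : ∀ s, HasDerivAt A (a s) s := fun s => (ha.integral_hasStrictDerivAt t₀ s).hasDerivAt
  have Ac : Continuous A := continuous_iff_continuousAt.2 fun s => (dA s).continuousAt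
  have dE : ∀ s, HasDerivAt (fun s => Real.exp (-A s)) (Real.exp (-A s) * -a s) s := fun s =>
    (dA s).neg.exp
  have dβ : ∀ s, HasDerivAt β (a s * α s + b s) s := fun s =>
    (((ha.mul hα).integral_hasStrictDerivAt t₀ s).hasDerivAt.const_add x₀).add
      (hb.integral_hasStrictDerivAt t₀ s).hasDerivAt
  have bEc : Continuous fun s => b s * Real.exp (-A s) := by fun_prop
  -- The `b` terms cancel, leaving a derivative whose sign is that of `α - β`, hence nonpositive on
  -- `[t₀, t]`.
  have dF : ∀ s, HasDerivAt
      (fun s => β s * Real.exp (-A s) - ∫ r in t₀..s, b r * Real.exp (-A r))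
      (a s * Real.exp (-A s) * (α s - β s)) s := fun s => by
    refine (((dβ s).mul (dE s)).sub
      (bEc.integral_hasStrictDerivAt t₀ s).hasDerivAt).congr_deriv ?_
    ring
  have hanti := antitoneOn_of_deriv_nonpos (convex_Icc t₀ t)
    (continuous_iff_continuousAt.2 fun s => (dF s).continuousAt).continuousOn
    (fun s _ => (dF s).differentiableAt.differentiableWithinAt) (fun s hs => by
      rw [(dF s).deriv]
      have hs' := interior_subset hs
      exact mul_nonpos_of_nonneg_of_nonpos (mul_nonneg (ha0 s hs') (Real.exp_pos _).le)
        (sub_nonpos.2 (hsub s hs')))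
  have h := hanti (left_mem_Icc.2 ht) (right_mem_Icc.2 ht) ht
  have hA0 : A t₀ = 0 := integral_same
  have hβ0 : β t₀ = x₀ := by simp [β]
  simp only [hA0, hβ0, integral_same, neg_zero, Real.exp_zero, mul_one, sub_zero] at h
  have hint : ∫ s in t₀..t, b s * Real.exp (∫ r in s..t, a r) =
      Real.exp (A t) * ∫ s in t₀..t, b s * Real.exp (-A s) := by
    rw [← intervalIntegral.integral_const_mul]
    refine integral_congr fun s _ => ?_
    have : ∫ r in s..t, a r = A t - A s :=
      (integral_interval_sub_left (ha.intervalIntegrable _ _) (ha.intervalIntegrable _ _)).symm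
    simp only [this, sub_eq_add_neg, Real.exp_add]
    ring
  rw [hint]
  calc α t ≤ β t := hsub t (right_mem_Icc.2 ht)
    _ = Real.exp (A t) * (β t * Real.exp (-A t)) := by
      rw [mul_left_comm, ← Real.exp_add]; simp
    _ ≤ Real.exp (A t) * (x₀ + ∫ s in t₀..t, b s * Real.exp (-A s)) := by
      gcongr; linarith
    _ = _ := by change _ = x₀ * Real.exp (A t) + _; ring

/-- The integral form of the Gronwall–Bellman inequality. -/
lemma gronwall_bellman {t₀ x₀ t : ℝ} (ht : t₀ ≤ t) {α a b : ℝ → ℝ}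
    (hα : ContinuousOn α (Icc t₀ t)) (ha : ContinuousOn a (Icc t₀ t))
    (hb : ContinuousOn b (Icc t₀ t)) (ha0 : ∀ s ∈ Icc t₀ t, 0 ≤ a s)
    (hsub : ∀ s ∈ Icc t₀ t,
      α s ≤ x₀ + (∫ r in t₀..s, a r * α r) + ∫ r in t₀..s, b r) :
    α t ≤ x₀ * Real.exp (∫ s in t₀..t, a s) +
      ∫ s in t₀..t, b s * Real.exp (∫ r in s..t, a r) := by
  -- Constant extension beyond the endpoints gives globally continuous data without changing any
  -- integral over subintervals of `[t₀, t]`.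
  let e : (ℝ → ℝ) → ℝ → ℝ := fun w => IccExtend ht ((Icc t₀ t).domRestrict w)
  have ec : ∀ w, ContinuousOn w (Icc t₀ t) → Continuous (e w) := fun w hw =>
    hw.domRestrict.Icc_extend'
  have e_eq : ∀ w, ∀ s ∈ Icc t₀ t, e w s = w s := fun w s hs => IccExtend_of_mem ht _ hs
  have hmem : ∀ s ∈ Icc t₀ t, ∀ s' ∈ Icc t₀ t, ∀ r ∈ uIcc s s', r ∈ Icc t₀ t :=
    fun s hs s' hs' => ordConnected_Icc.uIcc_subset hs hs'
  have int_eq : ∀ w, ∀ s ∈ Icc t₀ t, ∀ s' ∈ Icc t₀ t, ∫ r in s..s', e w r = ∫ r in s..s', w r :=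
    fun w s hs s' hs' => integral_congr fun r hr => e_eq w r (hmem s hs s' hs' r hr)
  have h0 : t₀ ∈ Icc t₀ t := left_mem_Icc.2 ht
  have h1 : t ∈ Icc t₀ t := right_mem_Icc.2 ht
  have h := gronwall_bellman_of_continuous (x₀ := x₀) ht (ec α hα) (ec a ha) (ec b hb)
    (fun s hs => by rw [e_eq a s hs]; exact ha0 s hs) fun s hs => by
      have : ∫ r in t₀..s, e a r * e α r = ∫ r in t₀..s, a r * α r :=
        integral_congr fun r hr => by
          simp only [e_eq _ r (hmem t₀ h0 s hs r hr)]
      rw [e_eq α s hs, int_eq b t₀ h0 s hs, this]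
      exact hsub s hs
  have hlast : ∫ s in t₀..t, e b s * Real.exp (∫ r in s..t, e a r) =
      ∫ s in t₀..t, b s * Real.exp (∫ r in s..t, a r) :=
    integral_congr fun s hs => by
      have hs' := hmem t₀ h0 t h1 s hs
      simp only [e_eq b s hs', int_eq a s hs' t h1]
  rwa [e_eq α t h1, int_eq a t₀ h0 t h1, hlast] at h

theorem corollary3 (t₀ x₀ : ℝ) :
    (∀ (D : Set (ℝ × ℝ)) (f : ℝ → ℝ → ℝ) (T : EReal) (xs : ℝ → ℝ),
      IsRelOpenNhd t₀ x₀ D →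
      ContinuousOn (fun p : ℝ × ℝ => f p.1 p.2) D →
      (∀ t x y : ℝ, (t, x) ∈ D → (t, y) ∈ D → x ≤ y → f t x ≤ f t y) →
      (t₀ : EReal) < T →
      IsGreatestSolution D f t₀ x₀ (halfOpen t₀ T) xs →
      ∀ α : ℝ → ℝ, ContinuousOn α (halfOpen t₀ T) →
        (∀ t ∈ halfOpen t₀ T, (t, α t) ∈ D) →
        (∀ t ∈ halfOpen t₀ T, α t ≤ x₀ + ∫ s in t₀..t, f s (α s)) →
        ∀ t ∈ halfOpen t₀ T,
          α t ≤ x₀ + ∫ s in t₀..t, f s (α s) ∧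
          x₀ + ∫ s in t₀..t, f s (α s) ≤ xs t) ∧
    (∀ (T : EReal) (α a b : ℝ → ℝ),
      (t₀ : EReal) < T →
      ContinuousOn α (halfOpen t₀ T) →
      ContinuousOn a (halfOpen t₀ T) →
      ContinuousOn b (halfOpen t₀ T) →
      (∀ t ∈ halfOpen t₀ T, 0 ≤ a t) →
      (∀ t ∈ halfOpen t₀ T,
        α t ≤ x₀ + (∫ s in t₀..t, a s * α s) + ∫ s in t₀..t, b s) →
      ∀ t ∈ halfOpen t₀ T,
        α t ≤ x₀ * Real.exp (∫ s in t₀..t, a s) +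
          ∫ s in t₀..t, b s * Real.exp (∫ r in s..t, a r)) := by
  refine ⟨fun D f T xs hD hf hmono _ hxs α hα hαD hsub t ht => ⟨hsub t ht,
    integral_le_greatest_solution hD hf hmono hxs hα hαD hsub t ht⟩,
    fun T α a b _ hα ha hb ha0 hsub t ht => ?_⟩
  have hI := Icc_subset_halfOpen ht
  exact gronwall_bellman ht.1 (hα.mono hI) (ha.mono hI) (hb.mono hI)
    (fun s hs => ha0 s (hI hs)) fun s hs => hsub s (hI hs)
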